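/- Let $p$ be a prime. Let $V=\{(n,k): n=0,1,2,\dots,\ 0\le k<p^n\}$ be the set of vertices of the $p$-adic tree, where $(n,k)$ labels the ball of diameter $p^{-n}$ in $\mathbb Z_p$ containing the integer $k$; let $\omega(n,k)=p^{-n}$, and let $H=\ell^2(V,\omega)$ be the Hilbert space of functions $f=(f_n(k))$ on $V$ with $\|f\|^2=\sum_{n\ge0}\sum_{0\le k<p^n}|f_n(k)|^2p^{-n}<\infty$. For a function $f$ on $V$ put $$(Df)_n(k)=p^n\Big(f_n(k)-\frac1p\sum_{0\le j<p}f_{n+1}(k+jp^n)\Big),$$ and let $D$ also denote the operator in $H$ given by this formula on its maximal domain $\{f\in H: Df\in H\}$; let $D^*$ be its adjoint. Put $\mathcal H=H\oplus H$, graded by $\gamma(f,g)=(f,-g)$, and $$\mathcal D=\begin{pmatrix}0&D\\ D^*&0\end{pmatrix},\qquad \operatorname{dom}\mathcal D=\operatorname{dom}D^*\oplus\operatorname{dom}D.$$ Let $A=C(\mathbb Z_p)$ be the C$^*$-algebra of continuous functions $\mathbb Z_p\to\mathbb C$, represented on $H$ by $(\pi(\phi)f)_n(k)=\phi(k)f_n(k)$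 and on $\mathcal H$ by $\Pi=\pi\oplus\pi$; let $\mathcal A\subset A$ be the $*$-subalgebra of Lipschitz functions, and $L(\phi)=\sup_{x\ne y}|\phi(x)-\phi(y)|/|x-y|_p$. Theorem. $(\mathcal A,\mathcal H,\mathcal D)$ is an even spectral triple for $A$: $\mathcal A$ is dense in $A$; $\mathcal D$ is self-adjoint; for every $\phi\in\mathcal A$ the operator $\Pi(\phi)$ preserves $\operatorname{dom}\mathcal D$ and $[\mathcal D,\Pi(\phi)]$ extends to a bounded operator on $\mathcal H$; the operator $(1+\mathcal D^2)^{-1/2}$ exists as a bounded positive operator and is compact; $\gamma$ is a self-adjoint involution, $\Pi(\phi)$ commutes with $\gamma$ for every $\phi\in A$, and $\mathcal D$ anticommutes with $\gamma$ (which preserves $\operatorname{dom}\mathcal D$). Moreover, $D:\operatorname{dom}D\to H$ is a bijection whose inverse $D^{-1}$ is a Hilbert–Schmidt operator on $H$; and for every $\phi\in\mathcal A$ the operator $\pi(\phi)$ preserves $\operatorname{dom}D$ and $\operatorname{dom}D^*$, and the commutators extend to bounded operators with $$\|[D,\pi(\phi)]\|\le L(\phi),\qquad \|[D^*,\pi(\phi)]\|\le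 L(\phi),\qquad \|[\mathcal D,\Pi(\phi)]\|\le L(\phi).$$ -/

import Mathlib

open MeasureTheory
open scoped ENNReal LinearPMap

/-! ### Operators on Hilbert spaces and even spectral triples -/

section General

universe u

/-- `S` is the everywhere defined bounded inverse of the partially defined operator `T`:
`S y = x` if and only if `x ∈ dom T` and `T x = y`. -/
def IsBoundedInverse {E F : Type*} [NormedAddCommGroup E] [InnerProductSpace ℂ E]
    [NormedAddCommGroup F] [InnerProductSpace ℂ F] (T : E →ₗ.[ℂ] F) (S : F →L[ℂ] E) : Prop :=
  ∀ (x : E) (y : F), S y = x ↔ (x, y) ∈ T.graph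

/-- Hilbert–Schmidt operators: `∑ ‖S eᵢ‖² < ∞` for an orthonormal (Hilbert) basis `(eᵢ)`. -/
def IsHilbertSchmidt {E : Type u} {F : Type*} [NormedAddCommGroup E] [InnerProductSpace ℂ E]
    [NormedAddCommGroup F] [InnerProductSpace ℂ F] (S : E →L[ℂ] F) : Prop :=
  ∃ (ι : Type u) (b : HilbertBasis ι ℂ E), Summable fun i => ‖S (b i)‖ ^ 2

/-- The bounded operator `B` is (the extension to the whole space of) the commutator
`[T, S] = T S - S T` of the partially defined operator `T` with the bounded operator `S`:
`S` maps `dom T` into itself and `T S x - S T x = B x` for all `x ∈ dom T`. When `dom T` is dense,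
`B` is unique, and its norm is the norm of the commutator. -/
def IsCommutator {E : Type*} [NormedAddCommGroup E] [InnerProductSpace ℂ E]
    (T : E →ₗ.[ℂ] E) (S B : E →L[ℂ] E) : Prop :=
  ∀ x : T.domain, ∃ h : S x ∈ T.domain, T ⟨S x, h⟩ - S (T x) = B x

/-- `R = (1 + T²)^{-1/2}`: the operator `R` is bounded and positive, and `R²` is the inverse
of `1 + T²`, i.e. `R² y = x` if and only if `x ∈ dom T`, `T x ∈ dom T` and `x + T (T x) = y`. -/
def IsInvSqrtOneAddSq {E : Type*} [NormedAddCommGroup E] [InnerProductSpace ℂ E]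
    (T : E →ₗ.[ℂ] E) (R : E →L[ℂ] E) : Prop :=
  R.IsPositive ∧
    ∀ x y : E, R (R y) = x ↔ ∃ z : E, (x, z) ∈ T.graph ∧ (z, y - x) ∈ T.graph

/-- `(𝒜, ℋ, 𝒟)` is a spectral triple for the unital C*-algebra `A`, represented on `ℋ`
by `Φ`. -/
structure IsSpectralTriple {A ℋ : Type*} [CStarAlgebra A] [NormedAddCommGroup ℋ]
    [InnerProductSpace ℂ ℋ] [CompleteSpace ℋ] (Φ : A →⋆ₐ[ℂ] (ℋ →L[ℂ] ℋ))
    (𝒜 : StarSubalgebra ℂ A) (𝒟 : ℋ →ₗ.[ℂ] ℋ) : Prop where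
  dense : Dense (𝒜 : Set A)
  selfAdjoint : IsSelfAdjoint 𝒟
  bounded_commutator : ∀ a ∈ 𝒜, ∃ B : ℋ →L[ℂ] ℋ, IsCommutator 𝒟 (Φ a) B
  compact : ∃ R : ℋ →L[ℂ] ℋ, IsInvSqrtOneAddSq 𝒟 R ∧ IsCompactOperator R

/-- An even spectral triple: the `ℤ/2`-grading of `ℋ` is the decomposition into the `±1`
eigenspaces of a self-adjoint involution `γ`, the representation is even (commutes with `γ`),
and `𝒟` is odd (anticommutes with `γ`). -/
structure IsEvenSpectralTriple {A ℋ : Type*} [CStarAlgebra A] [NormedAddCommGroup ℋ]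
    [InnerProductSpace ℂ ℋ] [CompleteSpace ℋ] (Φ : A →⋆ₐ[ℂ] (ℋ →L[ℂ] ℋ))
    (𝒜 : StarSubalgebra ℂ A) (𝒟 : ℋ →ₗ.[ℂ] ℋ) (γ : ℋ →L[ℂ] ℋ) : Prop
    extends IsSpectralTriple Φ 𝒜 𝒟 where
  grading_selfAdjoint : IsSelfAdjoint γ
  grading_sq : γ * γ = 1
  even : ∀ a : A, γ * Φ a = Φ a * γ
  odd : ∀ x : 𝒟.domain, ∃ h : γ x ∈ 𝒟.domain, 𝒟 ⟨γ x, h⟩ = -γ (𝒟 x)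

variable {E : Type*} [NormedAddCommGroup E] [InnerProductSpace ℂ E]

/-- The Hilbert space direct sum `E ⊕ E`. -/
abbrev Doubled (E : Type*) : Type _ := WithLp 2 (E × E)

/-- The diagonal operator `T ⊕ T` on `E ⊕ E`. -/
noncomputable def diagOp (T : E →L[ℂ] E) : Doubled E →L[ℂ] Doubled E :=
  ((WithLp.prodContinuousLinearEquiv 2 ℂ E E).symm : E × E →L[ℂ] Doubled E) ∘L
    (T.prodMap T) ∘L (WithLp.prodContinuousLinearEquiv 2 ℂ E E : Doubled E →L[ℂ] E × E)

theorem diagOp_apply (T : E →L[ℂ] E) (x : Doubled E) :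
    diagOp T x = WithLp.toLp 2 (T x.fst, T x.snd) := rfl

/-- The grading operator `(f, g) ↦ (f, -g)` on `E ⊕ E`. -/
noncomputable def gradingOp (E : Type*) [NormedAddCommGroup E] [InnerProductSpace ℂ E] :
    Doubled E →L[ℂ] Doubled E :=
  ((WithLp.prodContinuousLinearEquiv 2 ℂ E E).symm : E × E →L[ℂ] Doubled E) ∘L
    ((ContinuousLinearMap.id ℂ E).prodMap (-ContinuousLinearMap.id ℂ E)) ∘L
      (WithLp.prodContinuousLinearEquiv 2 ℂ E E : Doubled E →L[ℂ] E × E)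

theorem gradingOp_apply (x : Doubled E) :
    gradingOp E x = WithLp.toLp 2 (x.fst, -x.snd) := rfl

/-- The direct sum `π ⊕ π` of a representation with itself. -/
noncomputable def diagRep {A : Type*} [CStarAlgebra A] [CompleteSpace E]
    (π : A →⋆ₐ[ℂ] (E →L[ℂ] E)) : A →⋆ₐ[ℂ] (Doubled E →L[ℂ] Doubled E) where
  toFun a := diagOp (π a)
  map_one' := by
    refine ContinuousLinearMap.ext fun x => WithLp.ofLp_injective 2 (Prod.ext ?_ ?_) <;>
      simp [diagOp_apply]
  map_mul' a b := by
    refine ContinuousLinearMap.ext fun x => WithLp.ofLp_injective 2 (Prod.ext ?_ ?_) <;>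
      simp [diagOp_apply]
  map_zero' := by
    refine ContinuousLinearMap.ext fun x => WithLp.ofLp_injective 2 (Prod.ext ?_ ?_) <;>
      simp [diagOp_apply]
  map_add' a b := by
    refine ContinuousLinearMap.ext fun x => WithLp.ofLp_injective 2 (Prod.ext ?_ ?_) <;>
      simp [diagOp_apply]
  commutes' c := by
    refine ContinuousLinearMap.ext fun x => WithLp.ofLp_injective 2 (Prod.ext ?_ ?_) <;>
      simp [diagOp_apply, Algebra.algebraMap_eq_smul_one]
  map_star' a := by
    rw [ContinuousLinearMap.star_eq_adjoint, ContinuousLinearMap.eq_adjoint_iff]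
    intro x y
    simp [diagOp_apply, map_star, ContinuousLinearMap.star_eq_adjoint,
      ContinuousLinearMap.adjoint_inner_left]

/-- The operator matrix `[[0, D], [D*, 0]]` on `E ⊕ E`, with domain `dom D* ⊕ dom D`. -/
noncomputable def offDiag [CompleteSpace E] (D : E →ₗ.[ℂ] E) : Doubled E →ₗ.[ℂ] Doubled E where
  domain :=
    { carrier := {x | x.fst ∈ D†.domain ∧ x.snd ∈ D.domain}
      add_mem' := fun hx hy => ⟨D†.domain.add_mem hx.1 hy.1, D.domain.add_mem hx.2 hy.2⟩
      zero_mem' := ⟨D†.domain.zero_mem, D.domain.zero_mem⟩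
      smul_mem' := fun c _ hx => ⟨D†.domain.smul_mem c hx.1, D.domain.smul_mem c hx.2⟩ }
  toFun :=
    { toFun := fun x => WithLp.toLp 2 (D ⟨x.1.snd, x.2.2⟩, D† ⟨x.1.fst, x.2.1⟩)
      map_add' := fun x y => by
        rw [← WithLp.toLp_add, Prod.mk_add_mk, ← LinearPMap.map_add, ← LinearPMap.map_add]
        rfl
      map_smul' := fun c x => by
        rw [RingHom.id_apply, ← WithLp.toLp_smul, Prod.smul_mk, ← LinearPMap.map_smul,
          ← LinearPMap.map_smul]
        rfl }

end General

/-! ### The `p`-adic tree -/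

/-- The vertices of the `p`-adic tree: the pair `(n, k)` with `0 ≤ k < p ^ n` labels the ball of
diameter `p ^ (-n)` in `ℤ_p` that contains the integer `k`. -/
def Vertex (p : ℕ) : Type := Σ n : ℕ, Fin (p ^ n)

namespace Vertex

variable {p : ℕ}

instance : MeasurableSpace (Vertex p) := ⊤

instance : DiscreteMeasurableSpace (Vertex p) := ⟨fun _ => trivial⟩

instance : Countable (Vertex p) := inferInstanceAs (Countable (Σ n : ℕ, Fin (p ^ n)))

/-- The level `n` of the vertex `(n, k)`. -/
def level (v : Vertex p) : ℕ := v.1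

/-- The label `k` of the vertex `(n, k)`. -/
def label (v : Vertex p) : ℕ := v.2

/-- The `p` vertices `(n + 1, k + j p ^ n)`, `0 ≤ j < p`, immediately below `(n, k)`: the balls of
diameter `p ^ (-n-1)` contained in the ball `(n, k)`. -/
def child (v : Vertex p) (j : Fin p) : Vertex p :=
  ⟨v.1 + 1, v.2 + j * p ^ v.1, by
    have h1 : (v.2 : ℕ) < p ^ v.1 := v.2.2
    have h2 : ((j : ℕ) + 1) * p ^ v.1 ≤ p * p ^ v.1 := Nat.mul_le_mul_right _ j.2
    rw [pow_succ']
    linarith⟩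

/-- The weight `ω(v) = p ^ (-n)` of a vertex at level `n`: the diameter of the ball. -/
noncomputable def weight (v : Vertex p) : ℝ := ((p : ℝ) ^ v.level)⁻¹

end Vertex

section Tree

variable (p : ℕ)

/-- The measure on the set of vertices that gives each vertex `v` the mass `ω(v)`. -/
noncomputable def weightMeasure : Measure (Vertex p) :=
  Measure.sum fun v : Vertex p => ENNReal.ofReal v.weight • Measure.dirac v

/-- The weighted Hilbert space `H = ℓ²(V, ω)`, with `‖f‖² = ∑ |f v|² ω(v)`. -/
noncomputable abbrev TreeHilbert : Type := Lp ℂ 2 (weightMeasure p)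

/-- The forward derivative on functions on the tree,
`(D f)_n(k) = p ^ n (f_n(k) - (1 / p) ∑_{0 ≤ j < p} f_{n+1}(k + j p ^ n))`. -/
noncomputable def forwardDeriv : (Vertex p → ℂ) →ₗ[ℂ] (Vertex p → ℂ) where
  toFun f v := (p : ℂ) ^ v.level * (f v - (1 / (p : ℂ)) * ∑ j : Fin p, f (v.child j))
  map_add' f g := by
    funext v
    simp only [Pi.add_apply, Finset.sum_add_distrib]
    ring
  map_smul' c f := by
    funext v
    simp only [Pi.smul_apply, smul_eq_mul, RingHom.id_apply, ← Finset.mul_sum]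
    ring

theorem weightMeasure_singleton (v : Vertex p) :
    weightMeasure p {v} = ENNReal.ofReal v.weight := by
  rw [weightMeasure, Measure.sum_apply _ (MeasurableSet.singleton v), tsum_eq_single v]
  · simp
  · intro w hw
    simp [hw]

theorem TreeHilbert.ext {f g : TreeHilbert p} (h : ∀ v, f v = g v) : f = g :=
  Lp.ext (Filter.Eventually.of_forall h)

variable [Fact p.Prime]

variable {p} in
theorem Vertex.weight_pos (v : Vertex p) : 0 < v.weight :=
  inv_pos.2 (pow_pos (Nat.cast_pos.2 (Fact.out : p.Prime).pos) _)

variable {p} in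
/-- All vertices have positive mass, so functions that agree almost everywhere are equal. -/
theorem eq_of_ae_weightMeasure {f g : Vertex p → ℂ} (h : f =ᵐ[weightMeasure p] g) : f = g := by
  funext v
  by_contra hv
  have h0 : weightMeasure p {v} = 0 :=
    measure_mono_null (by rintro w rfl; exact hv) (ae_iff.1 h)
  rw [weightMeasure_singleton, ENNReal.ofReal_eq_zero] at h0
  exact absurd v.weight_pos (not_lt.2 h0)

theorem TreeHilbert.coe_add (f g : TreeHilbert p) : ⇑(f + g) = f + g :=
  eq_of_ae_weightMeasure (Lp.coeFn_add f g)

theorem TreeHilbert.coe_smul (c : ℂ) (f : TreeHilbert p) : ⇑(c • f) = c • ⇑f :=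
  eq_of_ae_weightMeasure (Lp.coeFn_smul c f)

theorem TreeHilbert.coe_zero : ⇑(0 : TreeHilbert p) = 0 :=
  eq_of_ae_weightMeasure (Lp.coeFn_zero ℂ 2 _)

/-- The operator `D` in `H`, on its maximal domain `{f ∈ H | D f ∈ H}`. -/
noncomputable def treeD : TreeHilbert p →ₗ.[ℂ] TreeHilbert p where
  domain :=
    { carrier := {f | MemLp (forwardDeriv p f) 2 (weightMeasure p)}
      add_mem' := fun {f g} hf hg => by
        change MemLp (forwardDeriv p _) 2 (weightMeasure p)
        rw [TreeHilbert.coe_add, map_add]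
        exact hf.add hg
      zero_mem' := by
        change MemLp (forwardDeriv p _) 2 (weightMeasure p)
        rw [TreeHilbert.coe_zero, map_zero]
        exact MemLp.zero
      smul_mem' := fun c f hf => by
        change MemLp (forwardDeriv p _) 2 (weightMeasure p)
        rw [TreeHilbert.coe_smul, map_smul]
        exact hf.const_smul c }
  toFun :=
    { toFun := fun f => MemLp.toLp (forwardDeriv p (f : TreeHilbert p)) f.2
      map_add' := fun f g => by
        rw [← MemLp.toLp_add]
        congr 1
        rw [Submodule.coe_add, TreeHilbert.coe_add, map_add]
      map_smul' := fun c f => by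
        rw [RingHom.id_apply, ← MemLp.toLp_const_smul]
        congr 1
        rw [Submodule.coe_smul, TreeHilbert.coe_smul, map_smul] }

/-! ### The representation of `C(ℤ_p)` -/

theorem memLp_mul (φ : C(ℤ_[p], ℂ)) (f : TreeHilbert p) :
    MemLp (fun v : Vertex p => φ (v.label : ℤ_[p]) * f v) 2 (weightMeasure p) :=
  (Lp.memLp f).of_le_mul (c := ‖φ‖) (measurable_of_countable _).aestronglyMeasurable
    (Filter.Eventually.of_forall fun v => by
      rw [norm_mul]
      exact mul_le_mul_of_nonneg_right (φ.norm_coe_le_norm _) (norm_nonneg _))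

/-- The multiplication operator `(π(φ) f)_n(k) = φ(k) f_n(k)` on `H`. -/
noncomputable def mulOp (φ : C(ℤ_[p], ℂ)) : TreeHilbert p →L[ℂ] TreeHilbert p :=
  LinearMap.mkContinuous
    { toFun := fun f => (memLp_mul p φ f).toLp _
      map_add' := fun f g => by
        rw [← MemLp.toLp_add]
        congr 1
        rw [TreeHilbert.coe_add]
        funext v
        exact mul_add _ _ _
      map_smul' := fun c f => by
        rw [RingHom.id_apply, ← MemLp.toLp_const_smul]
        congr 1
        rw [TreeHilbert.coe_smul]
        funext v
        exact mul_left_comm _ _ _ }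
    ‖φ‖ fun f => by
      refine Lp.norm_le_mul_norm_of_ae_le_mul ?_
      filter_upwards [MemLp.coeFn_toLp (memLp_mul p φ f)] with v hv
      rw [LinearMap.coe_mk, AddHom.coe_mk, hv, norm_mul]
      exact mul_le_mul_of_nonneg_right (φ.norm_coe_le_norm _) (norm_nonneg _)

theorem mulOp_coe (φ : C(ℤ_[p], ℂ)) (f : TreeHilbert p) :
    ⇑(mulOp p φ f) = fun v => φ (v.label : ℤ_[p]) * f v :=
  eq_of_ae_weightMeasure (MemLp.coeFn_toLp (memLp_mul p φ f))

/-- The representation `π` of `C(ℤ_p)` on `H` by multiplication operators. -/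
noncomputable def treeRep : C(ℤ_[p], ℂ) →⋆ₐ[ℂ] (TreeHilbert p →L[ℂ] TreeHilbert p) where
  toFun φ := mulOp p φ
  map_one' := by
    refine ContinuousLinearMap.ext fun f => TreeHilbert.ext p fun v => ?_
    simp [mulOp_coe]
  map_mul' φ ψ := by
    refine ContinuousLinearMap.ext fun f => TreeHilbert.ext p fun v => ?_
    simp [mulOp_coe, mul_assoc]
  map_zero' := by
    refine ContinuousLinearMap.ext fun f => TreeHilbert.ext p fun v => ?_
    change (mulOp p 0 f) v = (0 : TreeHilbert p) v
    rw [mulOp_coe, TreeHilbert.coe_zero]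
    exact zero_mul _
  map_add' φ ψ := by
    refine ContinuousLinearMap.ext fun f => TreeHilbert.ext p fun v => ?_
    change (mulOp p (φ + ψ) f) v = (mulOp p φ f + mulOp p ψ f : TreeHilbert p) v
    rw [TreeHilbert.coe_add, Pi.add_apply, mulOp_coe, mulOp_coe, mulOp_coe]
    exact add_mul _ _ _
  commutes' c := by
    refine ContinuousLinearMap.ext fun f => TreeHilbert.ext p fun v => ?_
    simp [mulOp_coe, TreeHilbert.coe_smul, Algebra.algebraMap_eq_smul_one]
  map_star' φ := by
    rw [ContinuousLinearMap.star_eq_adjoint, ContinuousLinearMap.eq_adjoint_iff]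
    intro f g
    rw [L2.inner_def, L2.inner_def]
    refine integral_congr_ae (Filter.Eventually.of_forall fun v => ?_)
    simp only [mulOp_coe, RCLike.inner_apply, ContinuousMap.star_apply, map_mul]
    rw [RCLike.star_def, RCLike.conj_conj]
    ring

/-! ### Lipschitz functions -/

variable {p} in
/-- The Lipschitz constant `L(φ) = sup_{x ≠ y} |φ(x) - φ(y)| / |x - y|_p`
(for Lipschitz `φ`, the only case in which it is used, the set is bounded). -/
noncomputable def lipConst (φ : C(ℤ_[p], ℂ)) : ℝ :=
  sSup {r : ℝ | ∃ x y : ℤ_[p], x ≠ y ∧ r = ‖φ x - φ y‖ / ‖x - y‖}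

/-- The `*`-algebra of Lipschitz functions on `ℤ_p`. -/
def lipschitzAlgebra : StarSubalgebra ℂ C(ℤ_[p], ℂ) where
  carrier := {φ | ∃ c : ℝ, ∀ x y : ℤ_[p], ‖φ x - φ y‖ ≤ c * ‖x - y‖}
  mul_mem' := by
    rintro φ ψ ⟨c, hc⟩ ⟨d, hd⟩
    refine ⟨‖φ‖ * d + c * ‖ψ‖, fun x y => ?_⟩
    have h : (φ * ψ) x - (φ * ψ) y = φ x * (ψ x - ψ y) + (φ x - φ y) * ψ y := by
      simp only [ContinuousMap.mul_apply]
      ring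
    have h1 : ‖φ x‖ * ‖ψ x - ψ y‖ ≤ ‖φ‖ * (d * ‖x - y‖) :=
      mul_le_mul (φ.norm_coe_le_norm x) (hd x y) (norm_nonneg _) (norm_nonneg _)
    have h2 : ‖φ x - φ y‖ * ‖ψ y‖ ≤ c * ‖x - y‖ * ‖ψ‖ :=
      mul_le_mul (hc x y) (ψ.norm_coe_le_norm y) (norm_nonneg _)
        ((norm_nonneg _).trans (hc x y))
    calc ‖(φ * ψ) x - (φ * ψ) y‖ ≤ ‖φ x‖ * ‖ψ x - ψ y‖ + ‖φ x - φ y‖ * ‖ψ y‖ := by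
          rw [h, ← norm_mul, ← norm_mul]
          exact norm_add_le _ _
      _ ≤ (‖φ‖ * d + c * ‖ψ‖) * ‖x - y‖ := by linarith
  add_mem' := by
    rintro φ ψ ⟨c, hc⟩ ⟨d, hd⟩
    refine ⟨c + d, fun x y => ?_⟩
    have h : (φ + ψ) x - (φ + ψ) y = (φ x - φ y) + (ψ x - ψ y) := by
      simp only [ContinuousMap.add_apply]
      ring
    rw [h]
    linarith [norm_add_le (φ x - φ y) (ψ x - ψ y), hc x y, hd x y]
  algebraMap_mem' := fun c => ⟨0, fun x y => by simp⟩
  star_mem' := by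
    rintro φ ⟨c, hc⟩
    refine ⟨c, fun x y => ?_⟩
    rw [ContinuousMap.star_apply, ContinuousMap.star_apply, ← star_sub, norm_star]
    exact hc x y

end Tree

/-! ### Hilbert–Schmidt operators -/

section HilbertSchmidt

universe u

/-! Let `M` be multiplication by the weight and `P` the average over children, so that formally `D =
M⁻¹(1 - P)`. On `H` one only has `‖P‖ ≤ 1`, so `1 - P` cannot be inverted by a Neumann series. But
weights shrink by `1/p` at each step down, so `P M = p⁻¹ M P` and `D M = 1 - A` with `A = p⁻¹ P`,
`‖A‖ ≤ 1/p < 1`. Hence `S = M (1 - A)⁻¹` is a right inverse of `D`. It is two-sided because `D` is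
injective on `H` (`forwardDeriv_eq_zero`): if `f = P f`, then `ω|f|²` is summable and at most its
sum over children, hence zero. `M` is diagonal with square-summable entries, so `S* = (1 - A*)⁻¹ M`
and `S` are Hilbert–Schmidt (`exists_isBoundedInverse_treeD`).

The rest on `𝒟` is read off from bounded inverses. Injectivity of `S*` makes `dom D` dense, `D*` has
inverse `S*`, and `𝒟` has the compact self-adjoint inverse `K = [[0, S*], [S, 0]]`. So `𝒟` is
self-adjoint and `(1 + 𝒟²)^{-1/2} = |K|(1 + K²)^{-1/2}`, which is compact.

In `[D, π(φ)]` the diagonal terms cancel; what remains is an average over children with coefficients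
`pⁿ(φ(v) - φ(child))`, bounded by `L(φ)` (`exists_isCommutator_treeD`). Taking adjoints, with `φ`
conjugated, gives the bound for `D*`. -/

theorem HilbertBasis.hasSum_norm_inner_sq {ι E : Type*} [NormedAddCommGroup E]
    [InnerProductSpace ℂ E] (b : HilbertBasis ι ℂ E) (x : E) :
    HasSum (fun i => ‖inner ℂ (b i) x‖ ^ 2) (‖x‖ ^ 2) := by
  have h := (b.hasSum_inner_mul_inner x x).mapL RCLike.reCLM
  simp only [RCLike.reCLM_apply, inner_self_eq_norm_sq, inner_mul_symm_re_eq_norm, norm_mul,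
    norm_inner_symm x, ← sq] at h
  exact h

/-- Both square sums are iterated sums of `|⟨c j, S (b i)⟩|²`, taken in opposite orders. -/
theorem IsHilbertSchmidt.adjoint {E F : Type u} [NormedAddCommGroup E] [InnerProductSpace ℂ E]
    [CompleteSpace E] [NormedAddCommGroup F] [InnerProductSpace ℂ F] [CompleteSpace F]
    {S : E →L[ℂ] F} (hS : IsHilbertSchmidt S) :
    IsHilbertSchmidt (ContinuousLinearMap.adjoint S) := by
  obtain ⟨ι, b, hb⟩ := hS
  obtain ⟨κ, c, -⟩ := exists_hilbertBasis ℂ F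
  refine ⟨κ, c, ?_⟩
  have h : Summable fun q : ι × κ => ‖inner ℂ (c q.2) (S (b q.1))‖ ^ 2 := by
    refine (summable_prod_of_nonneg fun _ => sq_nonneg _).2
      ⟨fun i => (c.hasSum_norm_inner_sq (S (b i))).summable, ?_⟩
    simpa only [(c.hasSum_norm_inner_sq (S (b _))).tsum_eq] using hb
  have h' := ((summable_prod_of_nonneg fun _ => sq_nonneg _).1 h.prod_symm).2
  refine h'.congr fun j => ?_
  rw [← (b.hasSum_norm_inner_sq _).tsum_eq]
  refine tsum_congr fun i => ?_
  rw [ContinuousLinearMap.adjoint_inner_right, norm_inner_symm]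
  rfl

theorem IsHilbertSchmidt.clm_comp {E : Type u} {F G : Type*} [NormedAddCommGroup E]
    [InnerProductSpace ℂ E] [NormedAddCommGroup F] [InnerProductSpace ℂ F]
    [NormedAddCommGroup G] [InnerProductSpace ℂ G] {S : E →L[ℂ] F} (hS : IsHilbertSchmidt S)
    (T : F →L[ℂ] G) : IsHilbertSchmidt (T ∘L S) := by
  obtain ⟨ι, b, hb⟩ := hS
  refine ⟨ι, b, Summable.of_nonneg_of_le (fun _ => sq_nonneg _) (fun i => ?_)
    (hb.mul_left (‖T‖ ^ 2))⟩
  rw [← mul_pow]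
  exact pow_le_pow_left₀ (norm_nonneg _) (T.le_opNorm _) 2

/-- `S` is the operator-norm limit of finite sums of the rank-one operators `x ↦ ⟨b i, x⟩ S (b i)`.
-/
theorem IsHilbertSchmidt.isCompactOperator {E : Type u} {F : Type*} [NormedAddCommGroup E]
    [InnerProductSpace ℂ E] [NormedAddCommGroup F] [InnerProductSpace ℂ F] [CompleteSpace F]
    {S : E →L[ℂ] F} (hS : IsHilbertSchmidt S) : IsCompactOperator S := by
  obtain ⟨ι, b, hb⟩ := hS
  let r : ι → E →L[ℂ] F := fun i => (innerSL ℂ (b i)).smulRight (S (b i))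
  have hr : ∀ i, r i ∈ compactOperator (RingHom.id ℂ) E F := fun i =>
    IsCompactOperator.clm_comp
      (isCompactOperator_of_locallyCompactSpace_dom (innerSL ℂ (b i)))
      (ContinuousLinearMap.toSpanSingleton ℂ (S (b i)))
  -- Cauchy–Schwarz and Bessel. The norms `‖r i‖` need not be summable, only their squares, so
  -- convergence below uses the Cauchy criterion with `ε ^ 2`.
  have hnorm : ∀ t : Finset ι, ‖∑ i ∈ t, r i‖ ^ 2 ≤ ∑ i ∈ t, ‖S (b i)‖ ^ 2 := by
    intro t
    have h0 : 0 ≤ ∑ i ∈ t, ‖S (b i)‖ ^ 2 := Finset.sum_nonneg fun _ _ => sq_nonneg _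
    rw [← Real.le_sqrt (norm_nonneg _) h0]
    refine ContinuousLinearMap.opNorm_le_bound _ (Real.sqrt_nonneg _) fun x => ?_
    rw [← abs_of_nonneg (mul_nonneg (Real.sqrt_nonneg _) (norm_nonneg x))]
    refine abs_le_of_sq_le_sq' ?_ (abs_nonneg _) |>.2
    rw [sq_abs, mul_pow, Real.sq_sqrt h0, sum_apply]
    calc ‖∑ i ∈ t, r i x‖ ^ 2 ≤ (∑ i ∈ t, ‖S (b i)‖ * ‖inner ℂ (b i) x‖) ^ 2 := by
          refine pow_le_pow_left₀ (norm_nonneg _) ((norm_sum_le _ _).trans_eq ?_) 2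
          exact Finset.sum_congr rfl fun i _ => by simp [r, norm_smul, mul_comm]
      _ ≤ (∑ i ∈ t, ‖S (b i)‖ ^ 2) * ∑ i ∈ t, ‖inner ℂ (b i) x‖ ^ 2 :=
          Finset.sum_mul_sq_le_sq_mul_sq _ _ _
      _ ≤ _ := by
          gcongr
          exact sum_le_hasSum _ (fun _ _ => sq_nonneg _) (b.hasSum_norm_inner_sq x)
  have hsum : Summable r := by
    rw [summable_iff_vanishing_norm]
    intro ε hε
    obtain ⟨s, hs⟩ := summable_iff_vanishing_norm.1 hb (ε ^ 2) (by positivity)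
    refine ⟨s, fun t ht => lt_of_pow_lt_pow_left₀ 2 hε.le ?_⟩
    exact ((hnorm t).trans (le_abs_self _)).trans_lt (hs t ht)
  have heq : ∑' i, r i = S := by
    refine ContinuousLinearMap.ext fun x => ?_
    have h1 : HasSum (fun i => r i x) ((∑' i, r i) x) :=
      hsum.hasSum.mapL (ContinuousLinearMap.apply ℂ F x)
    have h2 := (b.hasSum_repr x).mapL S
    simp only [map_smul, b.repr_apply_apply] at h2
    exact h1.unique h2
  have hlim := hsum.hasSum
  rw [heq] at hlim
  exact isCompactOperator_of_tendsto hlim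
    (Filter.Eventually.of_forall fun t => (compactOperator (RingHom.id ℂ) E F).sum_mem fun i _ => hr i)

end HilbertSchmidt

/-! ### Unbounded operators with bounded inverse, adjoints and 2×2 operator matrices -/

section Unbounded

variable {E : Type*} [NormedAddCommGroup E] [InnerProductSpace ℂ E]

theorem LinearPMap.mem_adjoint_graph_iff [CompleteSpace E] {T : E →ₗ.[ℂ] E}
    (hT : Dense (T.domain : Set E)) {x y : E} :
    (x, y) ∈ T†.graph ↔ ∀ u : T.domain, inner ℂ y (u : E) = inner ℂ x (T u) := by
  constructor
  · intro h u
    obtain ⟨v, hv, hv'⟩ := (LinearPMap.mem_graph_iff _).1 h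
    simp only at hv hv'
    rw [← hv', ← hv]
    exact LinearPMap.adjoint_isFormalAdjoint hT v u
  · intro h
    have hx : x ∈ T†.domain := LinearPMap.mem_adjoint_domain_of_exists x ⟨y, h⟩
    exact (LinearPMap.mem_graph_iff _).2 ⟨⟨x, hx⟩, rfl, LinearPMap.adjoint_apply_eq hT _ h⟩

theorem IsBoundedInverse.eq_of_graph {F : Type*} [NormedAddCommGroup F] [InnerProductSpace ℂ F]
    {T T' : E →ₗ.[ℂ] F} {S : F →L[ℂ] E}
    (h : IsBoundedInverse T S) (h' : IsBoundedInverse T' S) : T = T' := by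
  refine LinearPMap.eq_of_eq_graph (Submodule.ext fun q => ?_)
  exact (h q.1 q.2).symm.trans (h' q.1 q.2)

/-- The domain of `T` is the range of `S`, whose orthogonal complement is the kernel of the adjoint
of `S`. -/
theorem IsBoundedInverse.dense_domain [CompleteSpace E] {F : Type*} [NormedAddCommGroup F]
    [InnerProductSpace ℂ F] [CompleteSpace F]
    {T : E →ₗ.[ℂ] F} {S : F →L[ℂ] E} (h : IsBoundedInverse T S)
    (hS : Function.Injective (ContinuousLinearMap.adjoint S)) : Dense (T.domain : Set E) := by
  rw [Submodule.dense_iff_topologicalClosure_eq_top,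
    Submodule.topologicalClosure_eq_top_iff, Submodule.eq_bot_iff]
  intro x hx
  refine hS (ext_inner_left ℂ fun y => ?_)
  rw [ContinuousLinearMap.adjoint_inner_right, map_zero, inner_zero_right]
  obtain ⟨v, hv, -⟩ := (LinearPMap.mem_graph_iff _).1 ((h (S y) y).1 rfl)
  have hmem : S y ∈ T.domain := by
    rw [← show (v : E) = S y from hv]
    exact v.2
  exact (Submodule.mem_orthogonal _ _).1 hx _ hmem

theorem IsBoundedInverse.adjoint [CompleteSpace E] {T : E →ₗ.[ℂ] E} {S : E →L[ℂ] E}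
    (h : IsBoundedInverse T S) (hT : Dense (T.domain : Set E)) :
    IsBoundedInverse T† (ContinuousLinearMap.adjoint S) := by
  intro x y
  rw [LinearPMap.mem_adjoint_graph_iff hT]
  constructor
  · rintro rfl u
    rw [ContinuousLinearMap.adjoint_inner_left, (h u (T u)).2 (LinearPMap.mem_graph _ u)]
  · intro hu
    refine ext_inner_right ℂ fun w => ?_
    obtain ⟨v, hv, hv'⟩ := (LinearPMap.mem_graph_iff _).1 ((h (S w) w).1 rfl)
    simp only at hv hv'
    rw [ContinuousLinearMap.adjoint_inner_left, ← hv, hu, hv']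

/-- `T` and `T†` have the same bounded inverse, hence the same graph. Density of the domain is
automatic, since `S` is injective and equals its adjoint. -/
theorem IsBoundedInverse.isSelfAdjoint [CompleteSpace E] {T : E →ₗ.[ℂ] E} {S : E →L[ℂ] E}
    (h : IsBoundedInverse T S) (hS : IsSelfAdjoint S) : IsSelfAdjoint T := by
  have hS' : ContinuousLinearMap.adjoint S = S := hS
  have hinj : Function.Injective S := (injective_iff_map_eq_zero S).2 fun y hy =>
    LinearPMap.graph_fst_eq_zero_snd _ ((h 0 y).1 hy) rfl
  have h' := h.adjoint (h.dense_domain (by rwa [hS']))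
  rw [hS'] at h'
  exact h'.eq_of_graph h

/-- For `u ∈ dom T` and `x ∈ dom T†`, `⟨S*x, T u⟩ = ⟨x, T S u - B u⟩ = ⟨S*T†x - B*x, u⟩`; this
yields both the domain condition and the value. -/
theorem IsCommutator.adjoint [CompleteSpace E] {T : E →ₗ.[ℂ] E} {S B : E →L[ℂ] E}
    (h : IsCommutator T S B) (hT : Dense (T.domain : Set E)) :
    IsCommutator T† (ContinuousLinearMap.adjoint S) (-ContinuousLinearMap.adjoint B) := by
  intro x
  have hg : (ContinuousLinearMap.adjoint S x, ContinuousLinearMap.adjoint S (T† x) -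
      ContinuousLinearMap.adjoint B x) ∈ T†.graph := by
    rw [LinearPMap.mem_adjoint_graph_iff hT]
    intro u
    obtain ⟨hu, hB⟩ := h u
    have h1 := (LinearPMap.mem_adjoint_graph_iff hT).1 (LinearPMap.mem_graph T† x) ⟨S u, hu⟩
    simp only at h1
    rw [inner_sub_left, ContinuousLinearMap.adjoint_inner_left,
      ContinuousLinearMap.adjoint_inner_left, ContinuousLinearMap.adjoint_inner_left,
      h1, ← hB, inner_sub_right, sub_sub_cancel]
  obtain ⟨v, hv, hv'⟩ := (LinearPMap.mem_graph_iff _).1 hg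
  simp only at hv hv'
  refine ⟨hv ▸ v.2, ?_⟩
  have hvv : v = ⟨ContinuousLinearMap.adjoint S x, hv ▸ v.2⟩ := Subtype.ext hv
  rw [← hvv, hv']
  simp

/-- The operator matrix `[[0, A], [B, 0]]` with bounded entries. -/
noncomputable def offDiagOp (A B : E →L[ℂ] E) : Doubled E →L[ℂ] Doubled E :=
  ((WithLp.prodContinuousLinearEquiv 2 ℂ E E).symm : E × E →L[ℂ] Doubled E) ∘L
    ((A ∘L ContinuousLinearMap.snd ℂ E E).prod (B ∘L ContinuousLinearMap.fst ℂ E E)) ∘L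
      (WithLp.prodContinuousLinearEquiv 2 ℂ E E : Doubled E →L[ℂ] E × E)

theorem offDiagOp_apply (A B : E →L[ℂ] E) (x : Doubled E) :
    offDiagOp A B x = WithLp.toLp 2 (A x.snd, B x.fst) := rfl

/-- The entries act between orthogonal summands, so their bounds combine as a maximum and not as a
sum. -/
theorem norm_offDiagOp_le {A B : E →L[ℂ] E} {c : ℝ} (hA : ‖A‖ ≤ c) (hB : ‖B‖ ≤ c) :
    ‖offDiagOp A B‖ ≤ c := by
  have hc : 0 ≤ c := (norm_nonneg A).trans hA
  refine ContinuousLinearMap.opNorm_le_bound _ hc fun x => ?_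
  refine (pow_le_pow_iff_left₀ (norm_nonneg _) (by positivity) two_ne_zero).1 ?_
  rw [mul_pow, WithLp.prod_norm_sq_eq_of_L2, WithLp.prod_norm_sq_eq_of_L2, offDiagOp_apply]

  have h1 : ‖A x.snd‖ ^ 2 ≤ (c * ‖x.snd‖) ^ 2 :=
    pow_le_pow_left₀ (norm_nonneg _) (A.le_of_opNorm_le hA _) 2
  have h2 : ‖B x.fst‖ ^ 2 ≤ (c * ‖x.fst‖) ^ 2 :=
    pow_le_pow_left₀ (norm_nonneg _) (B.le_of_opNorm_le hB _) 2
  change ‖A x.snd‖ ^ 2 + ‖B x.fst‖ ^ 2 ≤ c ^ 2 * (‖x.fst‖ ^ 2 + ‖x.snd‖ ^ 2)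
  linarith

theorem isCompactOperator_offDiagOp {A B : E →L[ℂ] E} (hA : IsCompactOperator A)
    (hB : IsCompactOperator B) : IsCompactOperator (offDiagOp A B) := by
  have h1 : IsCompactOperator (offDiagOp A 0) := by
    have := (hA.comp_clm (WithLp.sndL 2 ℂ E E)).clm_comp
      (((WithLp.prodContinuousLinearEquiv 2 ℂ E E).symm : E × E →L[ℂ] Doubled E) ∘L
        ContinuousLinearMap.inl ℂ E E)
    exact this
  have h2 : IsCompactOperator (offDiagOp 0 B) := by
    have := (hB.comp_clm (WithLp.fstL 2 ℂ E E)).clm_comp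
      (((WithLp.prodContinuousLinearEquiv 2 ℂ E E).symm : E × E →L[ℂ] Doubled E) ∘L
        ContinuousLinearMap.inr ℂ E E)
    exact this
  have h12 : offDiagOp A B = offDiagOp A 0 + offDiagOp 0 B := by
    refine ContinuousLinearMap.ext fun x => ?_
    refine WithLp.ofLp_injective 2 (Prod.ext ?_ ?_) <;> simp [offDiagOp_apply]
  rw [h12]
  exact h1.add h2

theorem gradingOp_mul_self : gradingOp E * gradingOp E = 1 := by
  refine ContinuousLinearMap.ext fun x => WithLp.ofLp_injective 2 (Prod.ext ?_ ?_) <;>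
    simp [gradingOp_apply]

theorem gradingOp_mul_diagOp (T : E →L[ℂ] E) :
    gradingOp E * diagOp T = diagOp T * gradingOp E := by
  refine ContinuousLinearMap.ext fun x => WithLp.ofLp_injective 2 (Prod.ext ?_ ?_) <;>
    simp [gradingOp_apply, diagOp_apply]

variable [CompleteSpace E]

theorem isSelfAdjoint_offDiagOp (A : E →L[ℂ] E) :
    IsSelfAdjoint (offDiagOp (ContinuousLinearMap.adjoint A) A) := by
  rw [ContinuousLinearMap.isSelfAdjoint_iff_isSymmetric]
  intro x y
  simp [offDiagOp_apply, ContinuousLinearMap.adjoint_inner_left,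
    ContinuousLinearMap.adjoint_inner_right, add_comm]

theorem mem_graph_offDiag_iff {D : E →ₗ.[ℂ] E} {x y : Doubled E} :
    (x, y) ∈ (offDiag D).graph ↔ (x.fst, y.snd) ∈ D†.graph ∧ (x.snd, y.fst) ∈ D.graph := by
  simp only [LinearPMap.mem_graph_iff]
  constructor
  · rintro ⟨v, rfl, rfl⟩
    exact ⟨⟨⟨_, v.2.1⟩, rfl, rfl⟩, ⟨⟨_, v.2.2⟩, rfl, rfl⟩⟩
  · rintro ⟨⟨v, hv, hv'⟩, ⟨w, hw, hw'⟩⟩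
    refine ⟨⟨x, hv ▸ v.2, hw ▸ w.2⟩, rfl, WithLp.ofLp_injective 2 (Prod.ext ?_ ?_)⟩
    · exact (congrArg D (Subtype.ext hw.symm)).trans hw'
    · exact (congrArg D† (Subtype.ext hv.symm)).trans hv'

theorem IsBoundedInverse.offDiag {D : E →ₗ.[ℂ] E} {S : E →L[ℂ] E} (h : IsBoundedInverse D S)
    (hD : Dense (D.domain : Set E)) :
    IsBoundedInverse (offDiag D) (offDiagOp (ContinuousLinearMap.adjoint S) S) := by
  intro x y
  rw [mem_graph_offDiag_iff, ← h.adjoint hD, ← h]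
  constructor
  · rintro rfl
    exact ⟨rfl, rfl⟩
  · rintro ⟨h1, h2⟩
    exact WithLp.ofLp_injective 2 (Prod.ext h1 h2)

theorem IsCommutator.offDiag {D : E →ₗ.[ℂ] E} {S B C : E →L[ℂ] E} (hB : IsCommutator D S B)
    (hC : IsCommutator D† S C) : IsCommutator (offDiag D) (diagOp S) (offDiagOp B C) := by
  intro x
  obtain ⟨h1, h1'⟩ := hC ⟨x.1.fst, x.2.1⟩
  obtain ⟨h2, h2'⟩ := hB ⟨x.1.snd, x.2.2⟩
  exact ⟨⟨h1, h2⟩, WithLp.ofLp_injective 2 (Prod.ext h2' h1')⟩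

theorem isSelfAdjoint_gradingOp : IsSelfAdjoint (gradingOp E) := by
  rw [ContinuousLinearMap.isSelfAdjoint_iff_isSymmetric]
  intro x y
  simp [gradingOp_apply]

theorem offDiag_gradingOp (D : E →ₗ.[ℂ] E) (x : (offDiag D).domain) :
    ∃ h : gradingOp E x ∈ (offDiag D).domain,
      offDiag D ⟨gradingOp E x, h⟩ = -gradingOp E (offDiag D x) := by
  refine ⟨⟨x.2.1, D.domain.neg_mem x.2.2⟩, WithLp.ofLp_injective 2 (Prod.ext ?_ ?_)⟩
  · exact D.map_neg ⟨_, x.2.2⟩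
  · exact (neg_neg _).symm

end Unbounded

/-! ### The inverse square root of 1 + T² by functional calculus -/

section InvSqrt

variable {E : Type*} [NormedAddCommGroup E] [InnerProductSpace ℂ E] [CompleteSpace E]

/-- The operator `|K| (1 + K²)^{-1/2}`, which is `(1 + T²)^{-1/2}` for `T = K⁻¹`. -/
noncomputable def absDivSqrt (K : E →L[ℂ] E) : E →L[ℂ] E :=
  cfc (fun t : ℝ => |t| / √(1 + t ^ 2)) K

theorem continuous_abs_div_sqrt : Continuous fun t : ℝ => |t| / √(1 + t ^ 2) :=
  continuous_abs.div (by fun_prop) fun t => (Real.sqrt_pos.2 (by positivity)).ne'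

theorem absDivSqrt_mul_self_mul {K : E →L[ℂ] E} (hK : IsSelfAdjoint K) :
    absDivSqrt K * absDivSqrt K * (1 + K * K) = K * K := by
  have hc := continuous_abs_div_sqrt
  have h1 : cfc (fun t : ℝ => 1 + t * t) K = 1 + K * K := by
    rw [cfc_const_add (1 : ℝ) (fun t : ℝ => t * t) K, cfc_mul (fun t : ℝ => t) (fun t : ℝ => t) K,
      cfc_id' ℝ K, map_one]
  rw [← h1, absDivSqrt, ← cfc_mul _ _ K hc.continuousOn hc.continuousOn,
    ← cfc_mul _ _ K (by exact (hc.mul hc).continuousOn) (by fun_prop)]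
  rw [show K * K = cfc (fun t : ℝ => t * t) K by
    rw [cfc_mul (fun t : ℝ => t) (fun t : ℝ => t) K, cfc_id' ℝ K]]
  congr 1
  funext t
  have ht : (0 : ℝ) < 1 + t ^ 2 := by positivity
  rw [div_mul_div_comm, Real.mul_self_sqrt ht.le, abs_mul_abs_self]
  field_simp

/-- The function `|t|/√(1+t²)` is not `t` times a continuous function, because the sign jumps at
`0`. Replacing the sign by `t/(|t| + 1/(n+1))` gives compact operators `K * cfc (h n) K` that
converge in norm. -/
theorem isCompactOperator_absDivSqrt {K : E →L[ℂ] E} (hK : IsSelfAdjoint K)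
    (hc : IsCompactOperator K) : IsCompactOperator (absDivSqrt K) := by
  have hpos : ∀ t : ℝ, 0 < √(1 + t ^ 2) := fun t => Real.sqrt_pos.2 (by positivity)
  have hden : ∀ (n : ℕ) (t : ℝ), 0 < (|t| + 1 / ((n : ℝ) + 1)) * √(1 + t ^ 2) := fun n t =>
    mul_pos (by positivity) (hpos t)
  let h : ℕ → ℝ → ℝ := fun n t => t / ((|t| + 1 / ((n : ℝ) + 1)) * √(1 + t ^ 2))
  have hcont : ∀ n, Continuous (h n) := fun n =>
    continuous_id.div (by fun_prop) fun t => (hden n t).ne'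
  have hlim : Filter.Tendsto (fun n => K * cfc (h n) K) Filter.atTop (nhds (absDivSqrt K)) := by
    refine tendsto_iff_norm_sub_tendsto_zero.2 (squeeze_zero (fun _ => norm_nonneg _) (fun n => ?_)
      tendsto_one_div_add_atTop_nhds_zero_nat)
    have h1 : K * cfc (h n) K = cfc (fun t : ℝ => t * h n t) K := by
      rw [cfc_mul (fun t : ℝ => t) (h n) K (by fun_prop) (hcont n).continuousOn, cfc_id' ℝ K]
    rw [h1, absDivSqrt, ← cfc_sub _ _ K (by exact (continuous_id.mul (hcont n)).continuousOn)
      continuous_abs_div_sqrt.continuousOn]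
    refine norm_cfc_le (by positivity) fun t _ => ?_
    have ha : (0 : ℝ) < 1 / ((n : ℝ) + 1) := by positivity
    have hs : 1 ≤ √(1 + t ^ 2) := Real.one_le_sqrt.2 (by nlinarith [sq_nonneg t])
    generalize hA : 1 / ((n : ℝ) + 1) = a at *
    have hta : 0 < |t| + a := by positivity
    -- The quotient on the right is at most `1`, so the error is at most `a = 1/(n+1)` uniformly in
    -- `t`.
    have : t * h n t - |t| / √(1 + t ^ 2) = -(a * (|t| / ((|t| + a) * √(1 + t ^ 2)))) := by
      simp only [h, hA]
      have := (hpos t).ne'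
      have := hta.ne'
      field_simp
      rw [← sq_abs t]
      ring
    rw [this, norm_neg, Real.norm_of_nonneg (by positivity)]
    refine mul_le_of_le_one_right ha.le ((div_le_one (mul_pos hta (hpos t))).2 ?_)
    nlinarith [abs_nonneg t]
  exact isCompactOperator_of_tendsto hlim
    (Filter.Eventually.of_forall fun n => hc.comp_clm (cfc (h n) K))

theorem isInvSqrtOneAddSq_absDivSqrt {T : E →ₗ.[ℂ] E} {K : E →L[ℂ] E}
    (h : IsBoundedInverse T K) (hK : IsSelfAdjoint K) :
    IsInvSqrtOneAddSq T (absDivSqrt K) := by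
  refine ⟨(ContinuousLinearMap.nonneg_iff_isPositive _).1
    (cfc_nonneg fun t _ => by positivity), fun x y => ?_⟩
  have h1 := absDivSqrt_mul_self_mul hK
  have hcomm : Commute (absDivSqrt K) K := by
    have := cfc_commute_cfc (fun t : ℝ => |t| / √(1 + t ^ 2)) (fun t : ℝ => t) K
    rwa [cfc_id' ℝ K] at this
  have h2 : (1 + K * K) * (absDivSqrt K * absDivSqrt K) = K * K := by
    have hc1 : Commute (absDivSqrt K) (1 + K * K) :=
      (Commute.one_right _).add_right (hcomm.mul_right hcomm)
    exact (hc1.mul_left hc1).eq.symm.trans h1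
  have hinj : ∀ w : E, w + K (K w) = 0 → w = 0 := by
    intro w hw
    have h3 : inner ℂ w (w + K (K w)) = ((‖w‖ ^ 2 + ‖K w‖ ^ 2 : ℝ) : ℂ) := by
      rw [inner_add_right, ← ContinuousLinearMap.adjoint_inner_left,
        show ContinuousLinearMap.adjoint K = K from hK, inner_self_eq_norm_sq_to_K,
        inner_self_eq_norm_sq_to_K]
      push_cast
      rfl
    rw [hw, inner_zero_right] at h3
    have h4 : ‖w‖ ^ 2 + ‖K w‖ ^ 2 = 0 := by exact_mod_cast h3.symm
    have : ‖w‖ ^ 2 = 0 := by nlinarith [sq_nonneg ‖w‖, sq_nonneg ‖K w‖]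
    simpa using this
  have hR : absDivSqrt K (absDivSqrt K y) + K (K (absDivSqrt K (absDivSqrt K y))) = K (K y) :=
    congrArg (fun S : E →L[ℂ] E => S y) h2
  -- With `K = T⁻¹` the condition becomes `K (K (y - x)) = x`, that is `(1 + K²) x = K² y`. By `hR`,
  -- `R² y` solves this, and by `hinj` the solution is unique.
  simp only [← h _ _]
  constructor
  · rintro rfl
    refine ⟨_, ?_, rfl⟩
    rw [map_sub, map_sub, ← hR, add_sub_cancel_right]
  · rintro ⟨z, hz, rfl⟩
    refine sub_eq_zero.1 (hinj _ ?_)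
    rw [map_sub, map_sub, sub_eq_iff_eq_add, add_comm] at hz
    rw [map_sub, map_sub, sub_add_sub_comm, hR, hz, add_comm, sub_self]

end InvSqrt

/-! ### Summation over the tree -/

section TreeSums

variable {p : ℕ}

theorem Vertex.child_injective :
    Function.Injective fun q : Vertex p × Fin p => q.1.child q.2 := by
  rintro ⟨⟨n, k⟩, i⟩ ⟨⟨m, l⟩, j⟩ h
  obtain rfl : n = m := Nat.succ_injective (congrArg Sigma.fst h)
  have h1 : (k : ℕ) + i * p ^ n = l + j * p ^ n :=
    congrArg Fin.val (eq_of_heq (Sigma.mk.inj h).2)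
  have hk := k.2
  have hl := l.2
  have hpos : 0 < p ^ n := (Nat.zero_le _).trans_lt hk
  have h2 : (k : ℕ) = l := by
    have := congrArg (· % p ^ n) h1
    simpa [Nat.add_mul_mod_self_right, Nat.mod_eq_of_lt hk, Nat.mod_eq_of_lt hl] using this
  have h3 : (i : ℕ) = j := by
    rw [h2] at h1
    exact Nat.eq_of_mul_eq_mul_right hpos (Nat.add_left_cancel h1)
  rw [Fin.ext h2, Fin.ext h3]

/-- A vertex is the child of at most one vertex, so the double sum is a sub-sum of `∑ g`. -/
theorem Vertex.hasSum_sum_child_le {g : Vertex p → ℝ} (h0 : ∀ v, 0 ≤ g v) (hg : Summable g) :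
    Summable (fun v : Vertex p => ∑ j, g (v.child j)) ∧
      ∑' v : Vertex p, ∑ j, g (v.child j) ≤ ∑' v, g v := by
  have h1 : Summable fun q : Vertex p × Fin p => g (q.1.child q.2) :=
    hg.comp_injective Vertex.child_injective
  have h2 := h1.hasSum.prod_fiberwise fun v => hasSum_fintype fun j => g (v.child j)
  refine ⟨h2.summable, h2.tsum_eq.trans_le ?_⟩
  exact Summable.tsum_le_tsum_of_inj (fun q : Vertex p × Fin p => q.1.child q.2)
    Vertex.child_injective (fun _ _ => h0 _) (fun _ => le_rfl) h1 hg

/-- A summable nonnegative function on the tree that is subharmonic for the unnormalised sum over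
the vertices immediately below vanishes. -/
theorem Vertex.eq_zero_of_le_sum_child {g : Vertex p → ℝ} (h0 : ∀ v, 0 ≤ g v) (hg : Summable g)
    (hle : ∀ v, g v ≤ ∑ j, g (v.child j)) (v : Vertex p) : g v = 0 := by
  -- Tails of `g`: summing the hypothesis over levels `≥ n` bounds the tail from `n` by the tail
  -- from `n + 1`. With `n` the level of `v`, the tails differ by at least `g v`, so `g v ≤ 0`.
  let t : ℕ → Vertex p → ℝ := fun n => Set.indicator {w | n ≤ w.level} g
  have ht0 : ∀ n w, 0 ≤ t n w := fun n w => Set.indicator_nonneg (fun w _ => h0 w) w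
  have ht1 : ∀ {n w}, n ≤ level w → t n w = g w := fun {n w} h =>
    Set.indicator_of_mem (s := {w | n ≤ w.level}) h g
  have ht2 : ∀ {n w}, ¬n ≤ level w → t n w = 0 := fun {n w} h =>
    Set.indicator_of_notMem (s := {w | n ≤ w.level}) h g
  have hts : ∀ n, Summable (t n) := fun n => hg.indicator _
  have h1 : ∑' w, t v.level w ≤ ∑' w, t (v.level + 1) w := by
    obtain ⟨hs, hs'⟩ := Vertex.hasSum_sum_child_le (ht0 (v.level + 1)) (hts (v.level + 1))
    refine (Summable.tsum_le_tsum (fun w => ?_) (hts _) hs).trans hs'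
    by_cases hw : v.level ≤ w.level
    · rw [ht1 hw]
      refine (hle w).trans_eq (Finset.sum_congr rfl fun j _ => ?_)
      exact (ht1 (Nat.succ_le_succ hw : v.level + 1 ≤ (w.child j).level)).symm
    · rw [ht2 hw]
      exact Finset.sum_nonneg fun j _ => ht0 _ _
  have h2 : g v ≤ ∑' w, (t v.level w - t (v.level + 1) w) := by
    have hnn : ∀ w, 0 ≤ t v.level w - t (v.level + 1) w := fun w =>
      sub_nonneg.2 (Set.indicator_le_indicator_of_subset
        (fun _ h => Nat.le_of_succ_le h) h0 w)
    have hv : t v.level v - t (v.level + 1) v = g v := by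
      rw [ht1 le_rfl, ht2 (Nat.not_succ_le_self v.level), sub_zero]
    exact hv.symm.trans_le (((hts _).sub (hts _)).le_tsum v fun w _ => hnn w)
  rw [(hts _).tsum_sub (hts _)] at h2
  linarith [h0 v]

end TreeSums

/-! ### Bounded operators and an orthonormal basis on the tree -/

section TreeOperators

variable (p : ℕ) [Fact p.Prime]

theorem memLp_weightMeasure_iff {f : Vertex p → ℂ} :
    MemLp f 2 (weightMeasure p) ↔ Summable fun v => v.weight * ‖f v‖ ^ 2 := by
  rw [memLp_two_iff_integrable_sq_norm (measurable_of_countable f).aestronglyMeasurable,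
    weightMeasure, integrable_sum_dirac_iff fun _ => ENNReal.ofReal_ne_top]
  simp only [ENNReal.toReal_ofReal (Vertex.weight_pos _).le, norm_pow, norm_norm]

theorem TreeHilbert.hasSum_norm_sq (f : TreeHilbert p) :
    HasSum (fun v => v.weight * ‖f v‖ ^ 2) (‖f‖ ^ 2) := by
  have hs : Summable fun v : Vertex p => v.weight * ‖f v‖ ^ 2 :=
    (memLp_weightMeasure_iff p).1 (Lp.memLp f)
  have h1 : ‖f‖ ^ 2 = ∫ v, ‖f v‖ ^ 2 ∂weightMeasure p := by
    have h := inner_self_eq_norm_sq_to_K (𝕜 := ℂ) f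
    rw [L2.inner_def] at h
    simp only [inner_self_eq_norm_sq_to_K] at h
    have h' : ((‖f‖ ^ 2 : ℝ) : ℂ) = ((∫ v, ‖f v‖ ^ 2 ∂weightMeasure p : ℝ) : ℂ) := by
      rw [← integral_complex_ofReal]
      push_cast
      exact h.symm
    exact_mod_cast h'
  rw [h1]
  have h2 := hasSum_integral_sum_dirac (x := fun v : Vertex p => v) (f := fun v => ‖f v‖ ^ 2)
    (c := fun v : Vertex p => ENNReal.ofReal v.weight) (fun _ => ENNReal.ofReal_ne_top)
  simp only [ENNReal.toReal_ofReal (Vertex.weight_pos _).le, norm_pow, norm_norm, smul_eq_mul]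
    at h2
  exact h2 hs

/-- A linear map on functions on the tree that is bounded for the norm of `H` is given by a bounded
operator in `H`. -/
theorem TreeHilbert.exists_clm (L : (Vertex p → ℂ) →ₗ[ℂ] (Vertex p → ℂ)) {C : ℝ} (hC : 0 ≤ C)
    (hL : ∀ f : TreeHilbert p, Summable (fun v : Vertex p => v.weight * ‖L f v‖ ^ 2) ∧
      ∑' v : Vertex p, v.weight * ‖L f v‖ ^ 2 ≤ C ^ 2 * ‖f‖ ^ 2) :
    ∃ T : TreeHilbert p →L[ℂ] TreeHilbert p, (∀ f : TreeHilbert p, ⇑(T f) = L f) ∧ ‖T‖ ≤ C := by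
  have hm : ∀ f : TreeHilbert p, MemLp (L f) 2 (weightMeasure p) := fun f =>
    (memLp_weightMeasure_iff p).2 (hL f).1
  have hcoe : ∀ f : TreeHilbert p, ⇑((hm f).toLp (L f)) = L f := fun f =>
    eq_of_ae_weightMeasure (MemLp.coeFn_toLp (hm f))
  let T₀ : TreeHilbert p →ₗ[ℂ] TreeHilbert p :=
    { toFun := fun f => (hm f).toLp (L f)
      map_add' := fun f g => TreeHilbert.ext p fun v => by
        rw [TreeHilbert.coe_add p (MemLp.toLp _ (hm f)), hcoe, hcoe, hcoe, TreeHilbert.coe_add,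
          map_add]
      map_smul' := fun c f => TreeHilbert.ext p fun v => by
        rw [RingHom.id_apply, TreeHilbert.coe_smul p c (MemLp.toLp _ (hm f)), hcoe, hcoe,
          TreeHilbert.coe_smul, map_smul] }
  have hbound : ∀ f, ‖T₀ f‖ ≤ C * ‖f‖ := fun f => by
    refine (pow_le_pow_iff_left₀ (norm_nonneg _) (by positivity) two_ne_zero).1 ?_
    rw [mul_pow, ← (TreeHilbert.hasSum_norm_sq p (T₀ f)).tsum_eq,
      show ⇑(T₀ f) = L f from hcoe f]
    exact (hL f).2
  exact ⟨T₀.mkContinuous C hbound, hcoe, T₀.mkContinuous_norm_le hC hbound⟩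

theorem Vertex.weight_child {p : ℕ} (v : Vertex p) (j : Fin p) :
    (v.child j).weight = (p : ℝ)⁻¹ * v.weight := by
  change ((p : ℝ) ^ (v.1 + 1))⁻¹ = (p : ℝ)⁻¹ * ((p : ℝ) ^ v.1)⁻¹
  rw [pow_succ', mul_inv]

/-- The average over the vertices immediately below, with coefficients bounded by `C`, is a bounded
operator. -/
theorem TreeHilbert.exists_average (a : Vertex p → Fin p → ℂ) {C : ℝ} (hC : 0 ≤ C)
    (ha : ∀ v j, ‖a v j‖ ≤ C) :
    ∃ T : TreeHilbert p →L[ℂ] TreeHilbert p,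
      (∀ (f : TreeHilbert p) (v : Vertex p),
        T f v = (1 / (p : ℂ)) * ∑ j, a v j * f (v.child j)) ∧ ‖T‖ ≤ C := by
  have hp : (0 : ℝ) < p := Nat.cast_pos.2 (Fact.out : p.Prime).pos
  let L : (Vertex p → ℂ) →ₗ[ℂ] (Vertex p → ℂ) :=
    { toFun := fun f v => (1 / (p : ℂ)) * ∑ j, a v j * f (v.child j)
      map_add' := fun f g => by
        funext v
        simp only [Pi.add_apply, mul_add, Finset.sum_add_distrib]
      map_smul' := fun c f => by
        funext v
        simp only [Pi.smul_apply, smul_eq_mul, RingHom.id_apply, Finset.mul_sum]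
        exact Finset.sum_congr rfl fun _ _ => by ring }
  -- Cauchy–Schwarz over `p` children costs `p` against the `p⁻²` of the squared average; the
  -- remaining `p⁻¹` is the ratio of the weights of child and parent.
  have hbound : ∀ (f : Vertex p → ℂ) (v : Vertex p), v.weight * ‖L f v‖ ^ 2 ≤
      C ^ 2 * ∑ j, (v.child j).weight * ‖f (v.child j)‖ ^ 2 := by
    intro f v
    have h1 : ‖L f v‖ ≤ (p : ℝ)⁻¹ * (C * ∑ j, ‖f (v.child j)‖) := by
      change ‖(1 / (p : ℂ)) * ∑ j, a v j * f (v.child j)‖ ≤ _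
      rw [norm_mul, norm_div, norm_one, Complex.norm_natCast, one_div, Finset.mul_sum]
      refine mul_le_mul_of_nonneg_left (norm_sum_le_of_le _ fun j _ => ?_) (by positivity)
      rw [norm_mul]
      exact mul_le_mul_of_nonneg_right (ha v j) (norm_nonneg _)
    have h2 : (∑ j, ‖f (v.child j)‖) ^ 2 ≤ p * ∑ j, ‖f (v.child j)‖ ^ 2 := by
      simpa using sq_sum_le_card_mul_sum_sq (s := Finset.univ) (f := fun j => ‖f (v.child j)‖)
    calc v.weight * ‖L f v‖ ^ 2
        ≤ v.weight * ((p : ℝ)⁻¹ * (C * ∑ j, ‖f (v.child j)‖)) ^ 2 := by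
          have := v.weight_pos
          gcongr
      _ = v.weight * C ^ 2 * (p : ℝ)⁻¹ ^ 2 * (∑ j, ‖f (v.child j)‖) ^ 2 := by ring
      _ ≤ v.weight * C ^ 2 * (p : ℝ)⁻¹ ^ 2 * (p * ∑ j, ‖f (v.child j)‖ ^ 2) := by
          have := v.weight_pos
          gcongr
      _ = C ^ 2 * ∑ j, (v.child j).weight * ‖f (v.child j)‖ ^ 2 := by
          simp only [Vertex.weight_child, ← Finset.mul_sum]
          field_simp
  obtain ⟨T, hT, hT'⟩ := TreeHilbert.exists_clm p L hC fun f => by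
    have hf := TreeHilbert.hasSum_norm_sq p f
    obtain ⟨hs, hs'⟩ := Vertex.hasSum_sum_child_le
      (fun v => mul_nonneg v.weight_pos.le (sq_nonneg ‖f v‖)) hf.summable
    have hsum := Summable.of_nonneg_of_le
      (fun v => mul_nonneg v.weight_pos.le (sq_nonneg _)) (hbound f) (hs.mul_left (C ^ 2))
    refine ⟨hsum, (Summable.tsum_le_tsum (hbound f) hsum (hs.mul_left (C ^ 2))).trans ?_⟩
    rw [tsum_mul_left, ← hf.tsum_eq]
    exact mul_le_mul_of_nonneg_left hs' (sq_nonneg C)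
  exact ⟨T, fun f v => congrFun (hT f) v, hT'⟩

/-- Multiplication by the weight. -/
theorem TreeHilbert.exists_weightMul :
    ∃ T : TreeHilbert p →L[ℂ] TreeHilbert p,
      ∀ (f : TreeHilbert p) (v : Vertex p), T f v = (v.weight : ℂ) * f v := by
  have hw : ∀ v : Vertex p, v.weight ≤ 1 := fun v =>
    inv_le_one_of_one_le₀ (one_le_pow₀ (Nat.one_le_cast.2 (Fact.out : p.Prime).one_le))
  let L : (Vertex p → ℂ) →ₗ[ℂ] (Vertex p → ℂ) :=
    { toFun := fun f v => (v.weight : ℂ) * f v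
      map_add' := fun f g => funext fun v => mul_add _ _ _
      map_smul' := fun c f => funext fun v => mul_left_comm _ _ _ }
  have hbound : ∀ (f : Vertex p → ℂ) (v : Vertex p),
      v.weight * ‖L f v‖ ^ 2 ≤ v.weight * ‖f v‖ ^ 2 := by
    intro f v
    have h0 := v.weight_pos
    have h1 : ‖L f v‖ ≤ ‖f v‖ := by
      change ‖(v.weight : ℂ) * f v‖ ≤ _
      rw [norm_mul, Complex.norm_real, Real.norm_of_nonneg h0.le]
      exact mul_le_of_le_one_left (norm_nonneg _) (hw v)
    gcongr
  obtain ⟨T, hT, -⟩ := TreeHilbert.exists_clm p L zero_le_one fun f => by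
    have hf := TreeHilbert.hasSum_norm_sq p f
    have hsum := Summable.of_nonneg_of_le
      (fun v => mul_nonneg v.weight_pos.le (sq_nonneg _)) (hbound f) hf.summable
    rw [one_pow, one_mul, ← hf.tsum_eq]
    exact ⟨hsum, Summable.tsum_le_tsum (hbound f) hsum hf.summable⟩
  exact ⟨T, fun f v => congrFun (hT f) v⟩

theorem TreeHilbert.exists_hilbertBasis :
    ∃ b : HilbertBasis (Vertex p) ℂ (TreeHilbert p), ∀ v w, w ≠ v → b v w = 0 := by
  classical
  have hne : ∀ v : Vertex p, weightMeasure p {v} ≠ ∞ := fun v => by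
    rw [weightMeasure_singleton]
    exact ENNReal.ofReal_ne_top
  let e : Vertex p → TreeHilbert p := fun v =>
    -- The constant normalises the indicator of `{v}`, whose squared norm is the weight of `v`.
    indicatorConstLp 2 (MeasurableSet.singleton v) (hne v) (((√v.weight)⁻¹ : ℝ) : ℂ)
  have he : ∀ v, ⇑(e v) = Set.indicator {v} fun _ => (((√v.weight)⁻¹ : ℝ) : ℂ) := fun v =>
    eq_of_ae_weightMeasure indicatorConstLp_coeFn
  have hpos : ∀ v : Vertex p, 0 < √v.weight := fun v => Real.sqrt_pos.2 v.weight_pos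
  have hinner : ∀ (v : Vertex p) (f : TreeHilbert p),
      inner ℂ (e v) f = ((√v.weight : ℝ) : ℂ) * f v := by
    intro v f
    rw [L2.inner_indicatorConstLp_eq_inner_setIntegral, integral_singleton, measureReal_def,
      weightMeasure_singleton, ENNReal.toReal_ofReal v.weight_pos.le, RCLike.inner_apply,
      Complex.conj_ofReal, Complex.real_smul, mul_right_comm, ← Complex.ofReal_mul]
    congr 2
    rw [← div_eq_mul_inv, div_eq_iff (hpos v).ne', Real.mul_self_sqrt v.weight_pos.le]
  have ho : Orthonormal ℂ e := by
    rw [orthonormal_iff_ite]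
    intro v w
    rw [hinner, he]
    split_ifs with h
    · subst h
      rw [Set.indicator_of_mem (Set.mem_singleton v), ← Complex.ofReal_mul,
        mul_inv_cancel₀ (hpos v).ne', Complex.ofReal_one]
    · rw [Set.indicator_of_notMem (by simpa using h), mul_zero]
  refine ⟨HilbertBasis.mkOfOrthogonalEqBot ho ?_, fun v w h => ?_⟩
  · rw [Submodule.eq_bot_iff]
    intro f hf
    refine TreeHilbert.ext p fun v => ?_
    have h := (Submodule.mem_orthogonal _ _).1 hf (e v) (Submodule.subset_span ⟨v, rfl⟩)
    rw [hinner, mul_eq_zero, Complex.ofReal_eq_zero] at h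
    rw [TreeHilbert.coe_zero]
    exact h.resolve_left (hpos v).ne'
  · rw [HilbertBasis.coe_mkOfOrthogonalEqBot, he, Set.indicator_of_notMem (by simpa using h)]

/-- Level `n` contributes `pⁿ · p⁻²ⁿ = p⁻ⁿ`, a geometric series. This is the squared Hilbert–Schmidt
norm of multiplication by the weight. -/
theorem Vertex.summable_weight_sq : Summable fun v : Vertex p => v.weight ^ 2 := by
  have hp : (1 : ℝ) < p := Nat.one_lt_cast.2 (Fact.out : p.Prime).one_lt
  refine (summable_sigma_of_nonneg (f := fun v : Σ n : ℕ, Fin (p ^ n) => Vertex.weight v ^ 2)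
    fun _ => sq_nonneg _).2 ⟨fun n => (hasSum_fintype _).summable, ?_⟩
  refine (summable_geometric_of_lt_one (r := (p : ℝ)⁻¹) (by positivity)
    (inv_lt_one_of_one_lt₀ hp)).congr fun n => ?_
  rw [tsum_fintype]
  change _ = ∑ k : Fin (p ^ n), (((p : ℝ) ^ n)⁻¹) ^ 2
  rw [Finset.sum_const, Finset.card_univ, Fintype.card_fin, nsmul_eq_mul, Nat.cast_pow, inv_pow]
  have : (p : ℝ) ^ n ≠ 0 := by positivity
  field_simp

end TreeOperators

/-! ### Lipschitz functions on the p-adic integers -/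

section Lipschitz

variable {p : ℕ} [Fact p.Prime]

/-- The Lipschitz hypothesis bounds the set of quotients, so that its `sSup` is a true supremum. -/
theorem norm_sub_le_lipConst {φ : C(ℤ_[p], ℂ)} (hφ : φ ∈ lipschitzAlgebra p) (x y : ℤ_[p]) :
    ‖φ x - φ y‖ ≤ lipConst φ * ‖x - y‖ := by
  obtain rfl | hxy := eq_or_ne x y
  · simp
  obtain ⟨c, hc⟩ := hφ
  have hpos : 0 < ‖x - y‖ := norm_pos_iff.2 (sub_ne_zero.2 hxy)
  rw [← div_le_iff₀ hpos]
  refine le_csSup ⟨c, ?_⟩ ⟨x, y, hxy, rfl⟩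
  rintro r ⟨u, v, huv, rfl⟩
  exact (div_le_iff₀ (norm_pos_iff.2 (sub_ne_zero.2 huv))).2 (hc u v)

theorem lipConst_nonneg (φ : C(ℤ_[p], ℂ)) : 0 ≤ lipConst φ :=
  Real.sSup_nonneg (by rintro r ⟨x, y, -, rfl⟩; positivity)

theorem lipConst_star (φ : C(ℤ_[p], ℂ)) : lipConst (star φ) = lipConst φ := by
  simp only [lipConst, ContinuousMap.star_apply, ← star_sub, norm_star]

/-- Stone–Weierstrass: the 1-Lipschitz function `z ↦ ‖z - x‖` separates `x` from any other point. -/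
theorem dense_lipschitzAlgebra : Dense (lipschitzAlgebra p : Set C(ℤ_[p], ℂ)) := by
  have h := ContinuousMap.starSubalgebra_topologicalClosure_eq_top_of_separatesPoints
    (lipschitzAlgebra p) ?_
  · have h' := congrArg (fun A : StarSubalgebra ℂ C(ℤ_[p], ℂ) => (A : Set C(ℤ_[p], ℂ))) h
    simpa [dense_iff_closure_eq] using h'
  · intro x y hxy
    refine ⟨fun z => ((‖z - x‖ : ℝ) : ℂ), ⟨⟨fun z => ((‖z - x‖ : ℝ) : ℂ), by fun_prop⟩,
      ⟨1, fun u v => ?_⟩, rfl⟩, ?_⟩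
    · change ‖((‖u - x‖ : ℝ) : ℂ) - ((‖v - x‖ : ℝ) : ℂ)‖ ≤ _
      rw [← Complex.ofReal_sub, Complex.norm_real, one_mul]
      simpa using abs_norm_sub_norm_le (u - x) (v - x)
    · intro h
      have h' : ‖x - x‖ = ‖y - x‖ := Complex.ofReal_injective h
      rw [sub_self, norm_zero, eq_comm, norm_eq_zero, sub_eq_zero] at h'
      exact hxy h'.symm

theorem Vertex.norm_label_sub_child (v : Vertex p) (j : Fin p) :
    ‖(v.label : ℤ_[p]) - ((v.child j).label : ℤ_[p])‖ ≤ v.weight := by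
  have h : ((v.child j).label : ℤ_[p]) = v.label + ((j : ℕ) : ℤ_[p]) * (p : ℤ_[p]) ^ v.level := by
    change (((v.2 + j * p ^ v.1 : ℕ)) : ℤ_[p]) = _
    push_cast
    rfl
  rw [h, sub_add_cancel_left, norm_neg, norm_mul, PadicInt.norm_p_pow, zpow_neg, zpow_natCast]
  exact mul_le_of_le_one_left v.weight_pos.le (PadicInt.norm_le_one _)

end Lipschitz

/-! ### The forward derivative: inverse and commutators -/

section TreeDerivative

variable (p : ℕ) [Fact p.Prime]

theorem treeD_coe (f : (treeD p).domain) :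
    ⇑(treeD p f) = forwardDeriv p (f : TreeHilbert p) :=
  eq_of_ae_weightMeasure (MemLp.coeFn_toLp f.2)

/-- Since the domain is maximal, the pointwise equation already puts `f` in it. -/
theorem mem_graph_treeD_iff {f g : TreeHilbert p} :
    (f, g) ∈ (treeD p).graph ↔ forwardDeriv p f = g := by
  rw [LinearPMap.mem_graph_iff]
  constructor
  · rintro ⟨u, hu, hu'⟩
    simp only at hu hu'
    rw [← hu, ← hu', treeD_coe]
  · intro h
    have hf : f ∈ (treeD p).domain := by
      change MemLp (forwardDeriv p f) 2 (weightMeasure p)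
      rw [h]
      exact Lp.memLp g
    exact ⟨⟨f, hf⟩, rfl, TreeHilbert.ext p fun v => by rw [treeD_coe, h]⟩

theorem Vertex.pow_level_mul_weight {p : ℕ} [Fact p.Prime] (v : Vertex p) :
    (p : ℂ) ^ v.level * (v.weight : ℂ) = 1 := by
  have hp : (p : ℂ) ≠ 0 := Nat.cast_ne_zero.2 (Fact.out : p.Prime).ne_zero
  rw [Vertex.weight]
  push_cast
  exact mul_inv_cancel₀ (pow_ne_zero _ hp)

/-- Such an `f` equals its average over children, so by Cauchy–Schwarz
`Vertex.eq_zero_of_le_sum_child` applies to `ω|f|²`. -/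
theorem forwardDeriv_eq_zero {f : TreeHilbert p} (h : forwardDeriv p f = 0) : f = 0 := by
  have hp : (p : ℂ) ≠ 0 := Nat.cast_ne_zero.2 (Fact.out : p.Prime).ne_zero
  have hp' : (0 : ℝ) < p := Nat.cast_pos.2 (Fact.out : p.Prime).pos
  have hav : ∀ v : Vertex p, f v = (1 / (p : ℂ)) * ∑ j, f (v.child j) := fun v =>
    sub_eq_zero.1 ((mul_eq_zero.1 (congrFun h v)).resolve_left (pow_ne_zero _ hp))
  have hle : ∀ v : Vertex p, v.weight * ‖f v‖ ^ 2 ≤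
      ∑ j, (v.child j).weight * ‖f (v.child j)‖ ^ 2 := by
    intro v
    have h1 : ‖f v‖ ≤ (p : ℝ)⁻¹ * ∑ j, ‖f (v.child j)‖ := by
      rw [hav v, norm_mul, norm_div, norm_one, Complex.norm_natCast, one_div]
      gcongr
      exact norm_sum_le _ _
    have h2 : (∑ j, ‖f (v.child j)‖) ^ 2 ≤ p * ∑ j, ‖f (v.child j)‖ ^ 2 := by
      simpa using sq_sum_le_card_mul_sum_sq (s := Finset.univ) (f := fun j => ‖f (v.child j)‖)
    have := v.weight_pos
    calc v.weight * ‖f v‖ ^ 2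
        ≤ v.weight * ((p : ℝ)⁻¹ * ∑ j, ‖f (v.child j)‖) ^ 2 := by gcongr
      _ = v.weight * (p : ℝ)⁻¹ ^ 2 * (∑ j, ‖f (v.child j)‖) ^ 2 := by ring
      _ ≤ v.weight * (p : ℝ)⁻¹ ^ 2 * (p * ∑ j, ‖f (v.child j)‖ ^ 2) := by gcongr
      _ = ∑ j, (v.child j).weight * ‖f (v.child j)‖ ^ 2 := by
          simp only [Vertex.weight_child, ← Finset.mul_sum]
          field_simp
  refine TreeHilbert.ext p fun v => ?_
  have h0 := Vertex.eq_zero_of_le_sum_child (fun v => mul_nonneg v.weight_pos.le (sq_nonneg ‖f v‖))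
    (TreeHilbert.hasSum_norm_sq p f).summable hle v
  rw [TreeHilbert.coe_zero]
  simpa [v.weight_pos.ne'] using h0

/-- `D` has a Hilbert–Schmidt inverse whose adjoint is injective and Hilbert–Schmidt. -/
theorem exists_isBoundedInverse_treeD :
    ∃ S : TreeHilbert p →L[ℂ] TreeHilbert p, IsBoundedInverse (treeD p) S ∧ IsHilbertSchmidt S ∧
      IsHilbertSchmidt (ContinuousLinearMap.adjoint S) ∧
      Function.Injective (ContinuousLinearMap.adjoint S) := by
  have hp : (1 : ℝ) < p := Nat.one_lt_cast.2 (Fact.out : p.Prime).one_lt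
  obtain ⟨M, hM⟩ := TreeHilbert.exists_weightMul p
  -- The coefficient `p⁻¹`, on top of the averaging factor, is the weight ratio that appears when
  -- the average is moved past `M`.
  obtain ⟨A, hA, hA'⟩ := TreeHilbert.exists_average p (fun _ _ => ((p : ℂ))⁻¹)
    (C := (p : ℝ)⁻¹) (by positivity) (fun _ _ => by simp)
  have hMadj : ContinuousLinearMap.adjoint M = M := by
    refine ((ContinuousLinearMap.eq_adjoint_iff _ _).2 fun f g => ?_).symm
    rw [L2.inner_def, L2.inner_def]
    refine integral_congr_ae (Filter.Eventually.of_forall fun v => ?_)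
    simp only [hM, RCLike.inner_apply, map_mul, Complex.conj_ofReal]
    ring
  have hMHS : IsHilbertSchmidt M := by
    obtain ⟨b, hb⟩ := TreeHilbert.exists_hilbertBasis p
    refine ⟨Vertex p, b, (Vertex.summable_weight_sq p).congr fun v => ?_⟩
    have h : M (b v) = (v.weight : ℂ) • b v := TreeHilbert.ext p fun w => by
      rw [hM, TreeHilbert.coe_smul, Pi.smul_apply, smul_eq_mul]
      obtain rfl | hw := eq_or_ne w v
      · rfl
      · rw [hb v w hw, mul_zero, mul_zero]
    rw [h, norm_smul, b.orthonormal.1 v, mul_one, Complex.norm_real,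
      Real.norm_of_nonneg v.weight_pos.le]
  let U : (TreeHilbert p →L[ℂ] TreeHilbert p)ˣ :=
    Units.oneSub A (hA'.trans_lt (inv_lt_one_of_one_lt₀ hp))
  let T : TreeHilbert p →L[ℂ] TreeHilbert p := ↑U⁻¹
  have hUT : ∀ f, T f - A (T f) = f := fun f =>
    congrArg (fun B : TreeHilbert p →L[ℂ] TreeHilbert p => B f) U.mul_inv
  have hadj : ContinuousLinearMap.adjoint (M ∘L T) = ContinuousLinearMap.adjoint T ∘L M := by
    rw [ContinuousLinearMap.adjoint_comp, hMadj]
  have hHS : IsHilbertSchmidt (ContinuousLinearMap.adjoint (M ∘L T)) := by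
    rw [hadj]
    exact hMHS.clm_comp _
  -- The identity `D M = 1 - A`, applied to `T f = (1 - A)⁻¹ f`.
  have hD : ∀ f : TreeHilbert p, forwardDeriv p (M (T f)) = f := by
    intro f
    funext v
    have hv := congrArg (fun g : TreeHilbert p => g v) (eq_add_of_sub_eq (hUT f))
    simp only [TreeHilbert.coe_add, Pi.add_apply, hA] at hv
    have hpv := v.pow_level_mul_weight
    change (p : ℂ) ^ v.level * (M (T f) v - (1 / (p : ℂ)) * ∑ j, M (T f) (v.child j)) = f v
    simp only [hM, Vertex.weight_child]
    push_cast
    rw [← Finset.mul_sum] at hv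
    simp only [mul_assoc, ← Finset.mul_sum]
    linear_combination hpv * (T f v - 1 / (p : ℂ) * ((p : ℂ)⁻¹ * ∑ j, T f (v.child j))) + hv
  refine ⟨M ∘L T, fun f g => ?_, ?_, hHS, ?_⟩
  · rw [mem_graph_treeD_iff]
    constructor
    · rintro rfl
      exact hD g
    · intro h
      have h1 : f + (-1 : ℂ) • M (T g) = 0 := by
        refine forwardDeriv_eq_zero p ?_
        rw [TreeHilbert.coe_add, TreeHilbert.coe_smul, map_add, map_smul, h, hD]
        simp
      rw [neg_one_smul, ← sub_eq_add_neg, sub_eq_zero] at h1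
      exact h1.symm
  -- In `M ∘L T` the Hilbert–Schmidt factor stands on the left, out of reach of `clm_comp`; hence
  -- the detour through the adjoint.
  · simpa using hHS.adjoint
  · rw [hadj]
    have hMinj : Function.Injective M := (injective_iff_map_eq_zero M).2 fun f hf =>
      TreeHilbert.ext p fun v => by
        have := hM f v
        rw [hf, TreeHilbert.coe_zero, Pi.zero_apply, eq_comm, mul_eq_zero,
          Complex.ofReal_eq_zero] at this
        rw [TreeHilbert.coe_zero, Pi.zero_apply]
        exact this.resolve_left v.weight_pos.ne'
    have hTinj : Function.Injective (ContinuousLinearMap.adjoint T) := by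
      have h1 : star (U : TreeHilbert p →L[ℂ] TreeHilbert p) * star T = 1 := by
        rw [← star_mul, U.inv_mul, star_one]
      exact Function.LeftInverse.injective 
        (g := (star (U : TreeHilbert p →L[ℂ] TreeHilbert p) : TreeHilbert p →L[ℂ] TreeHilbert p))
        fun f => congrArg (fun B : TreeHilbert p →L[ℂ] TreeHilbert p => B f) h1
    exact hTinj.comp hMinj

/-- The terms in `f v` cancel. In the coefficients that are left, the factor `pⁿ` is offset by the
distance `≤ p⁻ⁿ` between the labels of a vertex and its child. -/
theorem exists_isCommutator_treeD {φ : C(ℤ_[p], ℂ)} (hφ : φ ∈ lipschitzAlgebra p) :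
    ∃ B : TreeHilbert p →L[ℂ] TreeHilbert p,
      IsCommutator (treeD p) (treeRep p φ) B ∧ ‖B‖ ≤ lipConst φ := by
  obtain ⟨B, hB, hB'⟩ := TreeHilbert.exists_average p
    (fun v j => (p : ℂ) ^ v.level * (φ v.label - φ (v.child j).label)) (lipConst_nonneg φ)
    (fun v j => by
      have hp : (0 : ℝ) < p := Nat.cast_pos.2 (Fact.out : p.Prime).pos
      have h1 := (norm_sub_le_lipConst hφ v.label (v.child j).label).trans
        (mul_le_mul_of_nonneg_left (v.norm_label_sub_child j) (lipConst_nonneg φ))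
      rw [norm_mul, norm_pow, Complex.norm_natCast]
      refine (mul_le_mul_of_nonneg_left h1 (by positivity)).trans_eq ?_
      rw [Vertex.weight, mul_left_comm, mul_inv_cancel₀ (by positivity), mul_one])
  refine ⟨B, fun f => ?_, hB'⟩
  have hfd : forwardDeriv p (treeRep p φ f) = (treeRep p φ (treeD p f) + B f : TreeHilbert p) := by
    funext v
    have h1 : ∀ (g : TreeHilbert p) (w : Vertex p), treeRep p φ g w = φ w.label * g w :=
      fun g w => congrFun (mulOp_coe p φ g) w
    rw [TreeHilbert.coe_add, Pi.add_apply, h1, treeD_coe, hB]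
    change (p : ℂ) ^ v.level * (treeRep p φ f v - (1 / (p : ℂ)) *
      ∑ j, treeRep p φ f (v.child j)) = φ v.label * ((p : ℂ) ^ v.level *
        ((f : TreeHilbert p) v - (1 / (p : ℂ)) * ∑ j, (f : TreeHilbert p) (v.child j))) + _
    simp only [h1, mul_assoc, sub_mul, mul_sub, Finset.sum_sub_distrib, ← Finset.mul_sum]
    ring
  obtain ⟨u, hu, hu'⟩ := (LinearPMap.mem_graph_iff _).1 ((mem_graph_treeD_iff p).2 hfd)
  simp only at hu hu'
  have hmem : treeRep p φ f ∈ (treeD p).domain := by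
    rw [← hu]
    exact u.2
  have huu : u = ⟨treeRep p φ f, hmem⟩ := Subtype.ext hu
  exact ⟨hmem, by rw [← huu, hu', add_sub_cancel_left]⟩

end TreeDerivative

/-! ### The spectral triple -/

theorem mainTheorem3 (p : ℕ) [Fact p.Prime] :
    IsEvenSpectralTriple (diagRep (treeRep p)) (lipschitzAlgebra p) (offDiag (treeD p))
        (gradingOp (TreeHilbert p)) ∧
      (∃ S : TreeHilbert p →L[ℂ] TreeHilbert p,
        IsBoundedInverse (treeD p) S ∧ IsHilbertSchmidt S) ∧
      ∀ φ ∈ lipschitzAlgebra p,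
        (∃ B : TreeHilbert p →L[ℂ] TreeHilbert p,
          IsCommutator (treeD p) (treeRep p φ) B ∧ ‖B‖ ≤ lipConst φ) ∧
        (∃ B : TreeHilbert p →L[ℂ] TreeHilbert p,
          IsCommutator (treeD p)† (treeRep p φ) B ∧ ‖B‖ ≤ lipConst φ) ∧
        ∃ B : Doubled (TreeHilbert p) →L[ℂ] Doubled (TreeHilbert p),
          IsCommutator (offDiag (treeD p)) (diagRep (treeRep p) φ) B ∧ ‖B‖ ≤ lipConst φ := by
  obtain ⟨S, hS, hHS, hHS', hinj⟩ := exists_isBoundedInverse_treeD p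
  have hdense := hS.dense_domain hinj
  have hcomm : ∀ φ ∈ lipschitzAlgebra p, ∃ B C : TreeHilbert p →L[ℂ] TreeHilbert p,
      (IsCommutator (treeD p) (treeRep p φ) B ∧ ‖B‖ ≤ lipConst φ) ∧
      IsCommutator (treeD p)† (treeRep p φ) C ∧ ‖C‖ ≤ lipConst φ := by
    intro φ hφ
    obtain ⟨B, hB⟩ := exists_isCommutator_treeD p hφ
    -- The adjoint of the commutator of `D` with `π(star φ)` is, up to sign, the commutator of `D*`
    -- with `π(φ)`.
    obtain ⟨C, hC, hC'⟩ := exists_isCommutator_treeD p (star_mem hφ)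
    refine ⟨B, -ContinuousLinearMap.adjoint C, hB, ?_, ?_⟩
    · have h := hC.adjoint hdense
      rwa [← ContinuousLinearMap.star_eq_adjoint, ← map_star, star_star] at h
    · rw [norm_neg, LinearIsometryEquiv.norm_map, ← lipConst_star]
      exact hC'
  have hK := hS.offDiag hdense
  have hKs := isSelfAdjoint_offDiagOp S
  refine ⟨⟨⟨dense_lipschitzAlgebra, hK.isSelfAdjoint hKs, fun φ hφ => ?_,
    _, isInvSqrtOneAddSq_absDivSqrt hK hKs, isCompactOperator_absDivSqrt hKs
      (isCompactOperator_offDiagOp hHS'.isCompactOperator hHS.isCompactOperator)⟩,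
    isSelfAdjoint_gradingOp, gradingOp_mul_self, fun φ => gradingOp_mul_diagOp _,
    offDiag_gradingOp _⟩, ⟨S, hS, hHS⟩, fun φ hφ => ?_⟩
  · obtain ⟨B, C, hB, hC⟩ := hcomm φ hφ
    exact ⟨_, hB.1.offDiag hC.1⟩
  · obtain ⟨B, C, hB, hC⟩ := hcomm φ hφ
    exact ⟨⟨B, hB⟩, ⟨C, hC⟩, _, hB.1.offDiag hC.1, norm_offDiagOp_le hB.2 hC.2⟩
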